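/- Consider a linear bandit with $K$ arms with features $x_1,\dots,x_K\in\mathbb{R}^d$ and an unknown parameter $\theta\in\mathbb{R}^d$ with $\|\theta\|_2<S$. In round $t\ge 1$ the agent pulls an arm $a_t\in[K]$ that depends only on the information $\mathcal F_{t-1}$ available after $t-1$ rounds, and observes $r_t=x_{a_t}^\top\theta+\varepsilon_t$, where the noise is conditionally $R$-sub-Gaussian with $R\ge 0$: $\varepsilon_t$ is $\mathcal F_t$-measurable and $\mathbb{E}[e^{s\varepsilon_t}\mid\mathcal F_{t-1}]\le e^{s^2R^2/2}$ almost surely for all $s\in\mathbb{R}$ and $t\ge1$. Let $a^*\in\arg\max_k x_k^\top\theta$ and $x^*=x_{a^*}$. Fix $\lambda>0$, $\varepsilon>0$ and $\delta\in(0,1)$, and put $$A_t=\lambda I+\sum_{s=1}^t x_{a_s}x_{a_s}^\top,\quad b_t=\sum_{s=1}^t r_sx_{a_s},\quad \hat\theta_t=A_t^{-1}b_t,\quad C_t=R\sqrt{2\log\frac{\det(A_t)^{1/2}\det(\lambda I)^{-1/2}}{\delta}}+\lambda^{1/2}S,$$ $y(i,j)=x_i-x_j$, $\hat\Delta_t(i,j)=y(i,j)^\top\hat\theta_t$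 and $\beta_t(i,j)=\sqrt{y(i,j)^\top A_t^{-1}y(i,j)}\;C_t$; let $T_k(t)$ be the number of pulls of arm $k$ in rounds $1,\dots,t$. LinGapE pulls each of the arms $1,\dots,K$ once in the first $K$ rounds. Then, for $t=K,K+1,\dots$, it chooses (breaking ties in any way that depends only on $\mathcal F_t$) $i_t\in\arg\max_i x_i^\top\hat\theta_t$ and $j_t\in\arg\max_j(\hat\Delta_t(j,i_t)+\beta_t(j,i_t))$ and sets $B(t)=\max_j(\hat\Delta_t(j,i_t)+\beta_t(j,i_t))$. If $B(t)\le\varepsilon$ it stops and returns $\hat a^*=i_t$; otherwise it pulls an arm $a_{t+1}$ selected, with $y=y(i_t,j_t)$, by one of the following two rules. 1. Greedy rule: $a_{t+1}\in\arg\min_{a\in[K]} y^\top(A_t+x_ax_a^\top)^{-1}y$. 2. Ratio-tracking rule: $a_{t+1}\in\arg\min_{a:\,p^*_a>0}T_a(t)/p^*_a$, where $p^*_k=|w^*_k|/\sum_l|w^*_l|$ and $w^*$ minimises $\sum_k|w_k|$ over all $w\in\mathbb{R}^K$ with $y=\sum_k w_kx_k$. Then, whichever of the two rules is employed, the arm $\hat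 a^*$ returned by LinGapE satisfies $$\mathbb{P}\left[(x^*-x_{\hat a^*})^\top\theta\ge\varepsilon\right]\le\delta ,$$ where the event means that LinGapE stops and returns an arm $\hat a^*$ with $(x^*-x_{\hat a^*})^\top\theta\ge\varepsilon$. -/

import Mathlib

open MeasureTheory

namespace LinGapE

open scoped Matrix

/-- The data of a run of LinGapE with `K` arms in dimension `d`: the features `x k` of the arms,
the regularisation parameter `lam`, the accuracy `eps`, the confidence level `delta`, the bound
`S` on the Euclidean norm of the unknown parameter, and the noise level `R`. -/
structure Input (K d : ℕ) where
  x : Fin K → Fin d → ℝ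
  lam : ℝ
  eps : ℝ
  delta : ℝ
  S : ℝ
  R : ℝ

/-- The two arm selection rules of LinGapE. -/
inductive Rule where
  | greedy
  | tracking

/-! Quantities computed along one sample path. The arm pulled in round `s + 1` is `a s`, and the
reward observed in that round is `r s`; an index `t` means "after `t` rounds". -/

section Path

variable {K d : ℕ} (P : Input K d) (a : ℕ → Fin K) (r : ℕ → ℝ)

/-- `A_t = lam I + ∑_{s ≤ t} x_{a_s} x_{a_s}ᵀ`. -/
noncomputable def A (t : ℕ) : Matrix (Fin d) (Fin d) ℝ :=
  P.lam • (1 : Matrix (Fin d) (Fin d) ℝ)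
    + ∑ s ∈ Finset.range t, Matrix.vecMulVec (P.x (a s)) (P.x (a s))

/-- `b_t = ∑_{s ≤ t} r_s x_{a_s}`. -/
noncomputable def b (t : ℕ) : Fin d → ℝ :=
  ∑ s ∈ Finset.range t, r s • P.x (a s)

/-- The regularised least-squares estimate `A_t⁻¹ b_t`. -/
noncomputable def thetaHat (t : ℕ) : Fin d → ℝ :=
  (A P a t)⁻¹ *ᵥ b P a r t

/-- `T_k(t)`, the number of pulls of arm `k` in the first `t` rounds. -/
def T (t : ℕ) (k : Fin K) : ℕ :=
  ((Finset.range t).filter (fun s => a s = k)).card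

/-- `y(i,j) = x_i - x_j`. -/
def y (i j : Fin K) : Fin d → ℝ := P.x i - P.x j

/-- The estimated gap `(x_i - x_j)ᵀ thetaHat_t`. -/
noncomputable def gapHat (t : ℕ) (i j : Fin K) : ℝ :=
  y P i j ⬝ᵥ thetaHat P a r t

/-- `C_t = R √(2 log (det(A_t)^{1/2} det(lam I)^{-1/2} / delta)) + lam^{1/2} S`. -/
noncomputable def C (t : ℕ) : ℝ :=
  P.R * Real.sqrt (2 * Real.log
      (Real.sqrt (A P a t).det
        * (Real.sqrt (P.lam • (1 : Matrix (Fin d) (Fin d) ℝ)).det)⁻¹ / P.delta))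
    + Real.sqrt P.lam * P.S

/-- The confidence width `‖y(i,j)‖_{A_t⁻¹} C_t`. -/
noncomputable def beta (t : ℕ) (i j : Fin K) : ℝ :=
  Real.sqrt (y P i j ⬝ᵥ ((A P a t)⁻¹ *ᵥ y P i j)) * C P a t

/-- The index `gapHat_t(j,i) + beta_t(j,i)` of arm `j` against arm `i`. -/
noncomputable def index (t : ℕ) (i j : Fin K) : ℝ :=
  gapHat P a r t j i + beta P a t j i

/-- `B(t) = max_j (gapHat_t(j,i_t) + beta_t(j,i_t))`, where `i` is the current `i_t`. -/
noncomputable def B (t : ℕ) (i : Fin K) : ℝ := ⨆ j : Fin K, index P a r t i j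

/-- `i` maximises the estimated reward after `t` rounds. -/
def IsLeader (t : ℕ) (i : Fin K) : Prop :=
  ∀ k, P.x k ⬝ᵥ thetaHat P a r t ≤ P.x i ⬝ᵥ thetaHat P a r t

/-- `j` maximises the index against `i` after `t` rounds. -/
def IsChallenger (t : ℕ) (i j : Fin K) : Prop :=
  ∀ k, index P a r t i k ≤ index P a r t i j

/-- `w` solves the problem of minimising `∑ |w_k|` subject to `v = ∑ w_k x_k`. -/
def IsMinimalRepresentation (v : Fin d → ℝ) (w : Fin K → ℝ) : Prop :=
  v = ∑ k, w k • P.x k ∧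
    ∀ w' : Fin K → ℝ, v = ∑ k, w' k • P.x k → ∑ k, |w k| ≤ ∑ k, |w' k|

/-- The ratios `p_k = |w_k| / ∑_l |w_l|`. -/
noncomputable def ratio (w : Fin K → ℝ) (k : Fin K) : ℝ := |w k| / ∑ l, |w l|

/-- Greedy rule: `c` minimises `y(i,j)ᵀ (A_t + x_c x_cᵀ)⁻¹ y(i,j)`. -/
def GreedyChoice (t : ℕ) (i j c : Fin K) : Prop :=
  ∀ k, y P i j ⬝ᵥ ((A P a t + Matrix.vecMulVec (P.x c) (P.x c))⁻¹ *ᵥ y P i j)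
    ≤ y P i j ⬝ᵥ ((A P a t + Matrix.vecMulVec (P.x k) (P.x k))⁻¹ *ᵥ y P i j)

/-- Ratio-tracking rule: `c` minimises `T_c(t) / p_c` among the arms with `p_c > 0`, where the
ratios `p` come from an optimal representation of `y(i,j)`. -/
def TrackingChoice (t : ℕ) (i j c : Fin K) : Prop :=
  ∃ w : Fin K → ℝ, IsMinimalRepresentation P (y P i j) w ∧ 0 < ratio w c ∧
    ∀ k, 0 < ratio w k → (T a t c : ℝ) / ratio w c ≤ (T a t k : ℝ) / ratio w k

/-- `c` is an arm that the given rule may select after `t` rounds for the pair `(i, j)`. -/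
def Rule.Selects (rule : Rule) (t : ℕ) (i j c : Fin K) : Prop :=
  match rule with
  | .greedy => GreedyChoice P a t i j c
  | .tracking => TrackingChoice P a t i j c

/-- With leaders `i`, the main loop is entered after `t` rounds: the initialisation (`K` rounds)
is over and no earlier stopping test has succeeded. -/
def Reaches (i : ℕ → Fin K) (t : ℕ) : Prop :=
  K ≤ t ∧ ∀ s, K ≤ s → s < t → P.eps < B P a r s (i s)

/-- With leaders `i`, the algorithm stops after exactly `t` rounds (and returns `i t`). -/
def StopsAt (i : ℕ → Fin K) (t : ℕ) : Prop :=
  Reaches P a r i t ∧ B P a r t (i t) ≤ P.eps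

/-- The sequences of arms `a`, rewards `r`, leaders `i` and challengers `j` are produced by
LinGapE with the given selection rule; ties may be broken in any way, and nothing is required of
the rounds after the algorithm has stopped. -/
structure IsPath (rule : Rule) (i j : ℕ → Fin K) : Prop where
  init : ∀ k : Fin K, a k = k
  leader : ∀ t, Reaches P a r i t → IsLeader P a r t (i t)
  challenger : ∀ t, Reaches P a r i t → IsChallenger P a r t (i t) (j t)
  select : ∀ t, Reaches P a r i t → P.eps < B P a r t (i t) →
    rule.Selects P a t (i t) (j t) (a t)

end Path

section Stochastic

variable {Ω : Type*} {m : MeasurableSpace Ω} {K d : ℕ}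

/-- The noise `ν t` of round `t + 1` is known after that round and is `R`-sub-Gaussian
conditionally on the first `t` rounds. -/
structure CondSubGaussian (μ : Measure Ω) (ℱ : Filtration ℕ m) (R : ℝ) (ν : ℕ → Ω → ℝ) :
    Prop where
  measurable : ∀ t, Measurable[ℱ (t + 1)] (ν t)
  integrable : ∀ t (s : ℝ), Integrable (fun ω => Real.exp (s * ν t ω)) μ
  bound : ∀ t (s : ℝ), μ[fun ω => Real.exp (s * ν t ω) | ℱ t]
    ≤ᵐ[μ] fun _ => Real.exp (s ^ 2 * R ^ 2 / 2)

/-- The reward of round `t + 1`: `x_{a_t}ᵀ θ` plus noise. -/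
def reward (P : Input K d) (θ : Fin d → ℝ) (a : ℕ → Ω → Fin K) (ν : ℕ → Ω → ℝ) (ω : Ω)
    (t : ℕ) : ℝ :=
  P.x (a t ω) ⬝ᵥ θ + ν t ω

/-- The random arms `a`, leaders `i` and challengers `j` are a run of LinGapE in the linear bandit
with parameter `θ` and noise `ν`. Everything chosen after `t` rounds (including the arm `a t` of
round `t + 1`) is determined by the information `ℱ t` available at that time. -/
structure IsRun (P : Input K d) (rule : Rule) (θ : Fin d → ℝ) (ℱ : Filtration ℕ m)
    (ν : ℕ → Ω → ℝ) (a i j : ℕ → Ω → Fin K) : Prop where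
  arm_measurable : ∀ t, Measurable[ℱ t] (a t)
  leader_measurable : ∀ t, Measurable[ℱ t] (i t)
  challenger_measurable : ∀ t, Measurable[ℱ t] (j t)
  path : ∀ ω, IsPath P (fun t => a t ω) (reward P θ a ν ω) rule
    (fun t => i t ω) (fun t => j t ω)

end Stochastic

end LinGapE

/-! The returned arm can be bad only if a confidence bound fails. Stopping means that `B` is at most
`eps`, so the upper confidence bound on the gap of every arm over the leader is at most `eps`, in
particular that of the best arm. If the true gaps lie below these bounds at the stopping time, the
leader is good. The bounds hold at all times simultaneously, so the stopping time may be arbitrary.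
Both selection rules are covered, because each arm is determined before its reward is seen.

The error of the least-squares estimate in a direction `v` splits into a noise term and a
regularisation bias, and Cauchy-Schwarz in the `A_t⁻¹` inner product bounds both
(`dotProduct_lt_add_width`). The bias is controlled by `‖θ‖ < S`, whose strictness excludes a gap of
exactly `eps`.

The noise term is handled by the method of mixtures. The process `mixture`, proportional to
`det(A_t)^(-1/2) exp(‖b_t‖² / (2R²))` with `b_t` built from the noise alone and its norm taken in
`A_t⁻¹`, starts at 1 and is a supermartingale (`setLIntegral_mixture_succ_le`). Ville's inequality
gives probability at most `delta` that it ever reaches `1/delta`. Below that level, taking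
logarithms gives the width `noiseWidth`. -/

namespace LinGapE

/-! ### Inverse quadratic forms and rank one updates -/

section RankOneUpdate

open Matrix

variable {n : Type*} [Fintype n] [DecidableEq n] {M : Matrix n n ℝ}

theorem dotProduct_inv_mulVec_comm (hM : M.PosDef) (u v : n → ℝ) :
    u ⬝ᵥ (M⁻¹ *ᵥ v) = v ⬝ᵥ (M⁻¹ *ᵥ u) := by
  have h : M⁻¹ᵀ = M⁻¹ := by simpa using hM.inv.isHermitian.eq
  rw [dotProduct_mulVec, ← mulVec_transpose, h, dotProduct_comm]

theorem dotProduct_inv_mulVec_nonneg (hM : M.PosDef) (u : n → ℝ) : 0 ≤ u ⬝ᵥ (M⁻¹ *ᵥ u) := by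
  simpa using hM.inv.posSemidef.dotProduct_mulVec_nonneg u

theorem mulVec_inv_mulVec (hM : M.PosDef) (u : n → ℝ) : M *ᵥ (M⁻¹ *ᵥ u) = u := by
  rw [mulVec_mulVec, mul_nonsing_inv _ hM.det_pos.ne'.isUnit, one_mulVec]

theorem inv_mulVec_eq_of_mulVec_eq (hM : M.PosDef) {u v : n → ℝ} (h : M *ᵥ v = u) :
    M⁻¹ *ᵥ u = v := by
  rw [← h, mulVec_mulVec, nonsing_inv_mul _ hM.det_pos.ne'.isUnit, one_mulVec]

omit [DecidableEq n] in
theorem posDef_add_vecMulVec (hM : M.PosDef) (x : n → ℝ) : (M + vecMulVec x x).PosDef :=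
  hM.add_posSemidef (by simpa using posSemidef_vecMulVec_self_star x)

/-- The matrix determinant lemma for a symmetric rank one update. -/
theorem det_add_vecMulVec (hM : M.PosDef) (x : n → ℝ) :
    (M + vecMulVec x x).det = M.det * (1 + x ⬝ᵥ (M⁻¹ *ᵥ x)) := by
  rw [vecMulVec_eq Unit, det_add_replicateCol_mul_replicateRow hM.det_pos.ne'.isUnit,
    det_unique (n := Unit), Matrix.mul_assoc, ← replicateCol_mulVec]
  simp

/-- The Sherman-Morrison formula, as an identity for the inverse quadratic form. -/
theorem quadratic_inv_add_vecMulVec (hM : M.PosDef) (x s : n → ℝ) (c : ℝ) :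
    (s + c • x) ⬝ᵥ ((M + vecMulVec x x)⁻¹ *ᵥ (s + c • x)) = s ⬝ᵥ (M⁻¹ *ᵥ s)
      + (2 * c * (x ⬝ᵥ (M⁻¹ *ᵥ s)) + c ^ 2 * (x ⬝ᵥ (M⁻¹ *ᵥ x)) - (x ⬝ᵥ (M⁻¹ *ᵥ s)) ^ 2)
        / (1 + x ⬝ᵥ (M⁻¹ *ᵥ x)) := by
  have hq := dotProduct_inv_mulVec_nonneg hM x
  have hs := dotProduct_inv_mulVec_comm hM s x
  set p := x ⬝ᵥ (M⁻¹ *ᵥ s) with hp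
  set q := x ⬝ᵥ (M⁻¹ *ᵥ x) with hq'
  have hq0 : (1 + q) ≠ 0 := by positivity
  -- The coefficient `(c - p) / (1 + q)` is forced by matching the multiples of `x` on both sides.
  have key : (M + vecMulVec x x) *ᵥ (M⁻¹ *ᵥ s + ((c - p) / (1 + q)) • (M⁻¹ *ᵥ x))
      = s + c • x := by
    rw [add_mulVec, mulVec_add, mulVec_smul, mulVec_inv_mulVec hM, mulVec_inv_mulVec hM,
      vecMulVec_mulVec, dotProduct_add, dotProduct_smul, ← hp, ← hq']
    ext i
    simp only [Pi.add_apply, Pi.smul_apply, smul_eq_mul, MulOpposite.smul_eq_mul_unop,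
      MulOpposite.unop_op]
    field_simp
    ring
  rw [inv_mulVec_eq_of_mulVec_eq (posDef_add_vecMulVec hM x) key]
  simp only [dotProduct_add, add_dotProduct, dotProduct_smul, smul_dotProduct, smul_eq_mul, hs,
    ← hp, ← hq']
  field_simp
  ring

/-- The Cauchy-Schwarz inequality for the inner product of a positive definite inverse. -/
theorem abs_dotProduct_inv_mulVec_le (hM : M.PosDef) (u v : n → ℝ) :
    |u ⬝ᵥ (M⁻¹ *ᵥ v)| ≤ √(u ⬝ᵥ (M⁻¹ *ᵥ u)) * √(v ⬝ᵥ (M⁻¹ *ᵥ v)) := by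
  have hu := dotProduct_inv_mulVec_nonneg hM u
  rw [← Real.sqrt_mul hu]
  refine Real.abs_le_sqrt ?_
  have h : ∀ t : ℝ, 0 ≤ (v ⬝ᵥ (M⁻¹ *ᵥ v)) * (t * t) + (2 * (u ⬝ᵥ (M⁻¹ *ᵥ v))) * t
      + u ⬝ᵥ (M⁻¹ *ᵥ u) := fun t => by
    have h := dotProduct_inv_mulVec_nonneg hM (u + t • v)
    simp only [mulVec_add, mulVec_smul, dotProduct_add, add_dotProduct, dotProduct_smul,
      smul_dotProduct, smul_eq_mul, dotProduct_inv_mulVec_comm hM v u] at h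
    linarith
  have := discrim_le_zero h
  rw [discrim] at this
  nlinarith

end RankOneUpdate

open scoped ENNReal NNReal

/-! ### Gaussian mixtures, conditional laws and Ville's inequality -/

section Mixture

open ProbabilityTheory

/-- The Gaussian integral of `z ↦ exp (c z ^ 2 / 2)`, for a mean and a variance written in the
form in which they occur in the method of mixtures. -/
theorem lintegral_exp_sq_gaussianReal {c p q : ℝ} (hc : 0 < c) (hq : 0 ≤ q) :
    ∫⁻ z, ENNReal.ofReal (Real.exp (c * z ^ 2 / 2))
        ∂gaussianReal (p / (c * (1 + q))) (q / (c * (1 + q))).toNNReal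
      = ENNReal.ofReal (√(1 + q) * Real.exp (p ^ 2 / (2 * c * (1 + q)))) := by
  -- For `q = 0` the Gaussian is a Dirac mass and has no density.
  rcases hq.eq_or_lt with rfl | hq
  · simp only [add_zero, mul_one, zero_div, Real.toNNReal_zero, gaussianReal_zero_var]
    rw [lintegral_dirac' _ (by fun_prop)]
    simp only [Real.sqrt_one, one_mul]
    congr 2
    field_simp
  have hv : (q / (c * (1 + q))).toNNReal ≠ 0 := by
    rw [ne_eq, Real.toNNReal_eq_zero, not_le]; positivity
  have hv' : (q / c).toNNReal ≠ 0 := by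
    rw [ne_eq, Real.toNNReal_eq_zero, not_le]; positivity
  rw [gaussianReal_of_var_ne_zero _ hv, lintegral_withDensity_eq_lintegral_mul _
    (measurable_gaussianPDF _ _) (by fun_prop)]
  -- Exponential tilting: the precision `c(1+q)/q` drops by `c` to `c/q`, which leaves a multiple of
  -- another Gaussian density.
  have h : ∀ z : ℝ, (gaussianPDF (p / (c * (1 + q))) (q / (c * (1 + q))).toNNReal
        * fun z => ENNReal.ofReal (Real.exp (c * z ^ 2 / 2))) z
      = ENNReal.ofReal (√(1 + q) * Real.exp (p ^ 2 / (2 * c * (1 + q))))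
        * gaussianPDF (p / c) (q / c).toNNReal z := fun z => by
    simp only [Pi.mul_apply, gaussianPDF, gaussianPDFReal]
    rw [← ENNReal.ofReal_mul (by positivity), ← ENNReal.ofReal_mul (by positivity),
      Real.coe_toNNReal _ (by positivity), Real.coe_toNNReal _ (by positivity)]
    congr 1
    have h1 : 2 * Real.pi * (q / c) = (2 * Real.pi * (q / (c * (1 + q)))) * (1 + q) := by
      field_simp
    rw [h1, Real.sqrt_mul (by positivity) (1 + q), mul_assoc, ← Real.exp_add]
    have h2 : -(z - p / (c * (1 + q))) ^ 2 / (2 * (q / (c * (1 + q)))) + c * z ^ 2 / 2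
        = p ^ 2 / (2 * c * (1 + q)) + -(z - p / c) ^ 2 / (2 * (q / c)) := by
      field_simp
      ring
    rw [h2, Real.exp_add]
    have h3 : √(1 + q) ≠ 0 := by positivity
    field_simp
  rw [lintegral_congr h, lintegral_const_mul _ (measurable_gaussianPDF _ _),
    lintegral_gaussianPDF_eq_one _ hv', mul_one]

/-- The one-step bound of the method of mixtures: a sub-Gaussian variable satisfies the
inequality that holds with equality for a Gaussian one. -/
theorem lintegral_exp_mixture_le_one {κ : Measure ℝ} [IsFiniteMeasure κ] {c p q : ℝ} (hc : 0 < c)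
    (hq : 0 ≤ q) (hκ : ∀ s : ℝ, ∫⁻ y, ENNReal.ofReal (Real.exp (s * y)) ∂κ
      ≤ ENNReal.ofReal (Real.exp (c * s ^ 2 / 2))) :
    ∫⁻ y, ENNReal.ofReal ((√(1 + q))⁻¹
      * Real.exp ((2 * y * p + y ^ 2 * q - p ^ 2) / (1 + q) / (2 * c))) ∂κ ≤ 1 := by
  -- Mean and variance are chosen so that the moment generating function of `N` at `y` is the
  -- `y`-dependent factor of the integrand. After exchanging integrals, the hypothesis on `κ`
  -- applies at each `z`, and the remaining Gaussian integral is the normalising constant `D`.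
  set N := gaussianReal (p / (c * (1 + q))) (q / (c * (1 + q))).toNNReal
  have hN : ∀ y : ℝ, ENNReal.ofReal (Real.exp ((2 * y * p + y ^ 2 * q) / (1 + q) / (2 * c)))
      = ∫⁻ z, ENNReal.ofReal (Real.exp (z * y)) ∂N := fun y => by
    have h := congrFun (mgf_fun_id_gaussianReal (μ := p / (c * (1 + q)))
      (v := (q / (c * (1 + q))).toNNReal)) y
    have hi := integrable_exp_mul_gaussianReal (μ := p / (c * (1 + q)))
      (v := (q / (c * (1 + q))).toNNReal) y
    rw [mgf, Real.coe_toNNReal _ (by positivity)] at h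
    simp_rw [mul_comm _ y]
    rw [← ofReal_integral_eq_lintegral_ofReal hi (.of_forall fun _ => (Real.exp_pos _).le), h]
    congr 2
    field_simp
  set D := √(1 + q) * Real.exp (p ^ 2 / (2 * c * (1 + q))) with hD
  have hD0 : 0 < D := by positivity
  have hsplit : ∀ y : ℝ, ENNReal.ofReal ((√(1 + q))⁻¹
      * Real.exp ((2 * y * p + y ^ 2 * q - p ^ 2) / (1 + q) / (2 * c)))
      = ENNReal.ofReal D⁻¹ * ∫⁻ z, ENNReal.ofReal (Real.exp (z * y)) ∂N := fun y => by
    rw [← hN, ← ENNReal.ofReal_mul (by positivity), hD, mul_inv, ← Real.exp_neg, mul_assoc _ (Real.exp _),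
      ← Real.exp_add]
    congr 3
    field_simp
    ring
  have hm : Measurable fun u : ℝ × ℝ => ENNReal.ofReal (Real.exp (u.2 * u.1)) := by fun_prop
  calc _ = ENNReal.ofReal D⁻¹ * ∫⁻ y, ∫⁻ z, ENNReal.ofReal (Real.exp (z * y)) ∂N ∂κ := by
        rw [lintegral_congr hsplit, lintegral_const_mul _ hm.lintegral_prod_right']
    _ = ENNReal.ofReal D⁻¹ * ∫⁻ z, ∫⁻ y, ENNReal.ofReal (Real.exp (z * y)) ∂κ ∂N := by
        rw [lintegral_lintegral_swap hm.aemeasurable]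
    _ ≤ ENNReal.ofReal D⁻¹ * ENNReal.ofReal D := by
        rw [hD, ← lintegral_exp_sq_gaussianReal hc hq]
        gcongr with z
        exact hκ z
    _ = 1 := by
        rw [← ENNReal.ofReal_mul (by positivity), inv_mul_cancel₀ hD0.ne', ENNReal.ofReal_one]

variable {Ω β : Type*} {mΩ : MeasurableSpace Ω} {mβ : MeasurableSpace β} {μ : Measure Ω}

/-- The conditional law of a conditionally sub-Gaussian variable is almost surely sub-Gaussian. -/
theorem ae_condDistrib_subGaussian [IsFiniteMeasure μ] {X : Ω → β} {Y : Ω → ℝ} {c : ℝ≥0}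
    (hX : Measurable X) (hY : Measurable Y)
    (hint : ∀ s : ℝ, Integrable (fun ω => Real.exp (s * Y ω)) μ)
    (hbound : ∀ s : ℝ, μ[fun ω => Real.exp (s * Y ω) | mβ.comap X]
      ≤ᵐ[μ] fun _ => Real.exp (c * s ^ 2 / 2)) :
    ∀ᵐ x ∂μ.map X, ∀ s : ℝ, ∫⁻ y, ENNReal.ofReal (Real.exp (s * y)) ∂condDistrib Y X μ x
      ≤ ENNReal.ofReal (Real.exp (c * s ^ 2 / 2)) := by
  have hi : ∀ s : ℝ, Integrable (fun y => Real.exp (s * id y))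
      (Measure.bind (μ.map X) (condDistrib Y X μ)) := fun s => by
    rw [condDistrib_comp_map hX.aemeasurable hY.aemeasurable,
      integrable_map_measure (by fun_prop) hY.aemeasurable]
    exact hint s
  have h : Kernel.HasSubgaussianMGF id c (condDistrib Y X μ) (μ.map X) := by
    -- The exceptional null set depends on `s`; countably many rational `s` suffice.
    refine .of_rat hi fun s => ?_
    have hsm : StronglyMeasurable fun y : ℝ => Real.exp (s * y) := by fun_prop
    refine (ae_map_iff hX.aemeasurable (measurableSet_le ?_ measurable_const)).2 ?_
    · exact (hsm.comp_measurable measurable_snd).integral_condDistrib.measurable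
    · filter_upwards [condExp_ae_eq_integral_condDistrib hX hY.aemeasurable hsm (hint s),
        hbound s] with ω h1 h2
      rw [h1] at h2
      simpa [mgf] using h2
  filter_upwards [h.mgf_le, h.ae_forall_integrable_exp_mul] with x h1 h2 s
  have h3 : Integrable (fun y => Real.exp (s * y)) (condDistrib Y X μ x) := h2 s
  rw [← ofReal_integral_eq_lintegral_ofReal h3 (.of_forall fun _ => (Real.exp_pos _).le)]
  exact ENNReal.ofReal_le_ofReal (h1 s)

theorem lintegral_prodMk_eq_condDistrib [IsFiniteMeasure μ] {X : Ω → β} {Y : Ω → ℝ}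
    (hX : Measurable X) (hY : Measurable Y) {H : β × ℝ → ℝ≥0∞} (hH : Measurable H) :
    ∫⁻ ω, H (X ω, Y ω) ∂μ = ∫⁻ x, ∫⁻ y, H (x, y) ∂condDistrib Y X μ x ∂μ.map X := by
  rw [← Measure.lintegral_compProd hH, compProd_map_condDistrib hY.aemeasurable,
    lintegral_map hH (hX.prodMk hY)]

/-- Given `X`, the quantities `G`, `p`, `q` are constants, so the one-step bound applies to the
conditional law of `Y`. The weight `G` is meant for the past of the supermartingale. -/
theorem lintegral_mul_exp_mixture_le [IsFiniteMeasure μ] {X : Ω → β} {Y : Ω → ℝ} {c : ℝ≥0}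
    (hc : 0 < c) (hX : Measurable X) (hY : Measurable Y)
    (hint : ∀ s : ℝ, Integrable (fun ω => Real.exp (s * Y ω)) μ)
    (hbound : ∀ s : ℝ, μ[fun ω => Real.exp (s * Y ω) | mβ.comap X]
      ≤ᵐ[μ] fun _ => Real.exp (c * s ^ 2 / 2))
    {G : β → ℝ≥0∞} {p q : β → ℝ} (hG : Measurable G) (hp : Measurable p) (hq : Measurable q)
    (hq0 : ∀ x, 0 ≤ q x) :
    ∫⁻ ω, G (X ω) * ENNReal.ofReal ((√(1 + q (X ω)))⁻¹ * Real.exp ((2 * Y ω * p (X ω)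
        + Y ω ^ 2 * q (X ω) - p (X ω) ^ 2) / (1 + q (X ω)) / (2 * (c : ℝ)))) ∂μ
      ≤ ∫⁻ ω, G (X ω) ∂μ := by
  have hF : Measurable fun u : β × ℝ => G u.1 * ENNReal.ofReal ((√(1 + q u.1))⁻¹
      * Real.exp ((2 * u.2 * p u.1 + u.2 ^ 2 * q u.1 - p u.1 ^ 2) / (1 + q u.1)
        / (2 * (c : ℝ)))) := by fun_prop
  refine (lintegral_prodMk_eq_condDistrib hX hY hF).trans_le ?_
  rw [← lintegral_map hG hX]
  refine lintegral_mono_ae ?_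
  filter_upwards [ae_condDistrib_subGaussian hX hY hint hbound] with x hx
  rw [lintegral_const_mul _ (by fun_prop)]
  exact mul_le_of_le_one_right'
    (lintegral_exp_mixture_le_one (NNReal.coe_pos.2 hc) (hq0 x) hx)

/-- **Ville's inequality** for a process with values in `ℝ≥0∞` that is a supermartingale in the
sense of the lower integral. -/
theorem measure_exists_le_of_supermartingale {ℱ : Filtration ℕ mΩ} {M : ℕ → Ω → ℝ≥0∞}
    (hM : ∀ t, Measurable[ℱ t] (M t))
    (hstep : ∀ t (E : Set Ω), MeasurableSet[ℱ t] E → ∫⁻ ω in E, M (t + 1) ω ∂μ ≤ ∫⁻ ω in E, M t ω ∂μ)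
    (c : ℝ≥0∞) : c * μ {ω | ∃ t, c ≤ M t ω} ≤ ∫⁻ ω, M 0 ω ∂μ := by
  let U : ℕ → Set Ω := fun n => {ω | ∃ t ≤ n, c ≤ M t ω}
  have hUm : ∀ n, MeasurableSet[ℱ n] (U n) := fun n => by
    have : U n = ⋃ t ∈ Set.Iic n, {ω | c ≤ M t ω} := by ext; simp [U]
    rw [this]
    refine MeasurableSet.biUnion (Set.to_countable _) fun t ht => ?_
    exact ℱ.mono ht _ (hM t measurableSet_Ici)
  have hUsucc : ∀ n, U (n + 1) = U n ∪ ((U n)ᶜ ∩ {ω | c ≤ M (n + 1) ω}) := fun n => by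
    ext ω
    simp only [U, Set.mem_union, Set.mem_inter_iff, Set.mem_compl_iff, Set.mem_ofPred_eq]
    constructor
    · rintro ⟨t, ht, h⟩
      by_cases hω : ∃ t ≤ n, c ≤ M t ω
      · exact .inl hω
      · rcases Nat.le_succ_iff.1 ht with ht | rfl
        · exact absurd ⟨t, ht, h⟩ hω
        · exact .inr ⟨hω, h⟩
    · rintro (⟨t, ht, h⟩ | ⟨_, h⟩)
      · exact ⟨t, ht.trans n.le_succ, h⟩
      · exact ⟨n + 1, le_rfl, h⟩
  -- The left side charges `c` to paths that have already crossed and keeps the process on the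
  -- others; one step cannot increase it.
  have hmain : ∀ n, c * μ (U n) + ∫⁻ ω in (U n)ᶜ, M n ω ∂μ ≤ ∫⁻ ω, M 0 ω ∂μ := fun n => by
    induction n with
    | zero =>
      have h0 := ℱ.le 0 _ (hUm 0)
      rw [← lintegral_add_compl (μ := μ) (M 0) h0]
      refine add_le_add ?_ le_rfl
      rw [← setLIntegral_const]
      refine setLIntegral_mono' h0 fun ω hω => ?_
      obtain ⟨t, ht, h⟩ := hω
      rwa [Nat.le_zero.1 ht] at h
    | succ n ih =>
      refine le_trans ?_ ih
      let V := (U n)ᶜ ∩ {ω | c ≤ M (n + 1) ω}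
      have hUV : U (n + 1) = U n ∪ V := hUsucc n
      have hV : MeasurableSet V := (ℱ.le n _ (hUm n)).compl.inter
        (measurableSet_le measurable_const ((hM (n + 1)).mono (ℱ.le _) le_rfl))
      have hcompl : (U (n + 1))ᶜ = (U n)ᶜ \ V := by
        rw [hUV, Set.compl_union, Set.sdiff_eq]
      calc c * μ (U (n + 1)) + ∫⁻ ω in (U (n + 1))ᶜ, M (n + 1) ω ∂μ
          ≤ c * μ (U n) + c * μ V + ∫⁻ ω in (U n)ᶜ \ V, M (n + 1) ω ∂μ := by
            rw [hcompl, ← mul_add, hUV]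
            exact add_le_add (mul_le_mul_right (measure_union_le _ _) _) le_rfl
        _ ≤ c * μ (U n) + (∫⁻ ω in (U n)ᶜ ∩ V, M (n + 1) ω ∂μ
            + ∫⁻ ω in (U n)ᶜ \ V, M (n + 1) ω ∂μ) := by
            have hVU : (U n)ᶜ ∩ V = V := Set.inter_eq_self_of_subset_right Set.inter_subset_left
            rw [add_assoc, hVU, ← setLIntegral_const V c]
            refine add_le_add le_rfl (add_le_add ?_ le_rfl)
            exact setLIntegral_mono' hV fun ω hω => hω.2
        _ = c * μ (U n) + ∫⁻ ω in (U n)ᶜ, M (n + 1) ω ∂μ := by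
            rw [lintegral_inter_add_sdiff _ _ hV]
        _ ≤ _ := by
            exact add_le_add le_rfl (hstep n _ (hUm n).compl)
  have hU : {ω | ∃ t, c ≤ M t ω} = ⋃ n, U n := by
    ext ω
    simp only [U, Set.mem_iUnion, Set.mem_ofPred_eq]
    exact ⟨fun ⟨t, h⟩ => ⟨t, t, le_rfl, h⟩, fun ⟨_, t, _, h⟩ => ⟨t, h⟩⟩
  have hmono : Monotone U := fun m n hmn ω ⟨t, ht, h⟩ => ⟨t, ht.trans hmn, h⟩
  rw [hU, hmono.measure_iUnion, ENNReal.mul_iSup]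
  exact iSup_le fun n => le_self_add.trans (hmain n)

end Mixture

open Matrix

/-! ### Deterministic estimates along one sample path -/

section Path

variable {K d : ℕ} {P : Input K d} {a : ℕ → Fin K} {n : ℕ → ℝ} {θ : Fin d → ℝ}

theorem A_succ (P : Input K d) (a : ℕ → Fin K) (t : ℕ) :
    A P a (t + 1) = A P a t + vecMulVec (P.x (a t)) (P.x (a t)) := by
  simp [A, Finset.sum_range_succ, add_assoc]

theorem b_succ (P : Input K d) (a : ℕ → Fin K) (n : ℕ → ℝ) (t : ℕ) :
    b P a n (t + 1) = b P a n t + n t • P.x (a t) := by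
  simp [b, Finset.sum_range_succ]

theorem posDef_A (hlam : 0 < P.lam) (a : ℕ → Fin K) (t : ℕ) : (A P a t).PosDef := by
  induction t with
  | zero => simpa [A] using PosDef.one.smul hlam
  | succ t ih => exact A_succ P a t ▸ posDef_add_vecMulVec ih _

theorem lam_mul_dotProduct_le (P : Input K d) (a : ℕ → Fin K) (t : ℕ) (v : Fin d → ℝ) :
    P.lam * (v ⬝ᵥ v) ≤ v ⬝ᵥ (A P a t *ᵥ v) := by
  induction t with
  | zero => simp [A, smul_mulVec]
  | succ t ih =>
    have h : v ⬝ᵥ (vecMulVec (P.x (a t)) (P.x (a t)) *ᵥ v) = (P.x (a t) ⬝ᵥ v) ^ 2 := by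
      rw [vecMulVec_mulVec, dotProduct_smul, dotProduct_comm v]
      simp [sq]
    rw [A_succ, add_mulVec, dotProduct_add, h]
    nlinarith [sq_nonneg (P.x (a t) ⬝ᵥ v)]

/-- Inversion reverses the order `lam I ≤ A_t`: with `z = A_t⁻¹ v`, combine `lam (z ⬝ᵥ z) ≤ v ⬝ᵥ z`
with the nonnegativity of the square of `v - lam z`. -/
theorem lam_mul_dotProduct_inv_le (hlam : 0 < P.lam) (a : ℕ → Fin K) (t : ℕ) (v : Fin d → ℝ) :
    P.lam * (v ⬝ᵥ ((A P a t)⁻¹ *ᵥ v)) ≤ v ⬝ᵥ v := by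
  have hA := posDef_A hlam a t
  set z := (A P a t)⁻¹ *ᵥ v with hz
  have h1 := lam_mul_dotProduct_le P a t z
  rw [hz, mulVec_inv_mulVec hA, ← hz, dotProduct_comm z v] at h1
  have h2 : 0 ≤ (v - P.lam • z) ⬝ᵥ (v - P.lam • z) := by
    simpa using dotProduct_star_self_nonneg (v - P.lam • z)
  simp only [sub_dotProduct, dotProduct_sub, smul_dotProduct, dotProduct_smul, smul_eq_mul,
    dotProduct_comm z v] at h2
  nlinarith [mul_le_mul_of_nonneg_left h1 hlam.le]

theorem b_add_reward (P : Input K d) (a : ℕ → Fin K) (n : ℕ → ℝ) (θ : Fin d → ℝ) (t : ℕ) :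
    b P a (fun s => P.x (a s) ⬝ᵥ θ + n s) t = A P a t *ᵥ θ + (b P a n t - P.lam • θ) := by
  induction t with
  | zero => simp [b, A, smul_mulVec]
  | succ t ih =>
    rw [b_succ, b_succ, A_succ, add_mulVec, ih, vecMulVec_mulVec]
    ext i
    simp
    ring

/-- The noise and bias terms correspond to the two summands of `C`. -/
theorem dotProduct_thetaHat (hlam : 0 < P.lam) (a : ℕ → Fin K) (n : ℕ → ℝ) (θ v : Fin d → ℝ)
    (t : ℕ) : v ⬝ᵥ thetaHat P a (fun s => P.x (a s) ⬝ᵥ θ + n s) t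
      = v ⬝ᵥ θ + v ⬝ᵥ ((A P a t)⁻¹ *ᵥ b P a n t) - P.lam * (v ⬝ᵥ ((A P a t)⁻¹ *ᵥ θ)) := by
  rw [thetaHat, b_add_reward, mulVec_add, inv_mulVec_eq_of_mulVec_eq (posDef_A hlam a t) rfl,
    mulVec_sub, mulVec_smul, dotProduct_add, dotProduct_sub, dotProduct_smul, smul_eq_mul,
    add_sub_assoc]

/-- The part of the confidence width `C_t` that comes from the noise. -/
noncomputable def noiseWidth (P : Input K d) (a : ℕ → Fin K) (t : ℕ) : ℝ :=
  P.R * √(2 * Real.log (√(A P a t).det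
    * (√(P.lam • (1 : Matrix (Fin d) (Fin d) ℝ)).det)⁻¹ / P.delta))

/-- Where the noise is within its confidence width, the least-squares estimate satisfies the
confidence bound in every direction `v`, strictly unless `v = 0`. -/
theorem dotProduct_lt_add_width (hlam : 0 < P.lam) (hθ : ‖WithLp.toLp 2 θ‖ < P.S) {t : ℕ}
    (hn : √(b P a n t ⬝ᵥ ((A P a t)⁻¹ *ᵥ b P a n t)) ≤ noiseWidth P a t)
    {v : Fin d → ℝ} (hv : v ≠ 0) :
    v ⬝ᵥ θ < v ⬝ᵥ thetaHat P a (fun s => P.x (a s) ⬝ᵥ θ + n s) t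
      + √(v ⬝ᵥ ((A P a t)⁻¹ *ᵥ v)) * C P a t := by
  have hA := posDef_A hlam a t
  have hpos : 0 < √(v ⬝ᵥ ((A P a t)⁻¹ *ᵥ v)) :=
    Real.sqrt_pos.2 (by simpa using hA.inv.dotProduct_mulVec_pos hv)
  have h1 := (abs_le.1 (abs_dotProduct_inv_mulVec_le hA v (b P a n t))).1
  have h2 := (le_abs_self _).trans (abs_dotProduct_inv_mulVec_le hA v θ)
  have h3 : P.lam * √(θ ⬝ᵥ ((A P a t)⁻¹ *ᵥ θ)) < √P.lam * P.S := by
    have hnorm : ‖WithLp.toLp 2 θ‖ = √(θ ⬝ᵥ θ) := by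
      rw [EuclideanSpace.norm_eq]
      simp [dotProduct, sq]
    have h4 : √P.lam * √(θ ⬝ᵥ ((A P a t)⁻¹ *ᵥ θ)) ≤ √(θ ⬝ᵥ θ) := by
      rw [← Real.sqrt_mul hlam.le]
      exact Real.sqrt_le_sqrt (lam_mul_dotProduct_inv_le hlam a t θ)
    have h5 : 0 < √P.lam := Real.sqrt_pos.2 hlam
    calc P.lam * √(θ ⬝ᵥ ((A P a t)⁻¹ *ᵥ θ))
        = √P.lam * (√P.lam * √(θ ⬝ᵥ ((A P a t)⁻¹ *ᵥ θ))) := by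
          rw [← mul_assoc, Real.mul_self_sqrt hlam.le]
      _ < √P.lam * P.S := mul_lt_mul_of_pos_left (h4.trans_lt (hnorm ▸ hθ)) h5
  have h6 : C P a t = noiseWidth P a t + √P.lam * P.S := rfl
  rw [dotProduct_thetaHat hlam, h6]
  nlinarith [mul_le_mul_of_nonneg_left hn hpos.le, mul_lt_mul_of_pos_left h3 hpos,
    mul_le_mul_of_nonneg_left h2 hlam.le]

/-- If LinGapE stops while the noise is within its confidence width, the returned arm is good. -/
theorem dotProduct_lt_of_stopsAt (hlam : 0 < P.lam) (heps : 0 < P.eps)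
    (hθ : ‖WithLp.toLp 2 θ‖ < P.S) {i : ℕ → Fin K} {t : ℕ}
    (hn : √(b P a n t ⬝ᵥ ((A P a t)⁻¹ *ᵥ b P a n t)) ≤ noiseWidth P a t)
    (hend : StopsAt P a (fun s => P.x (a s) ⬝ᵥ θ + n s) i t) (k : Fin K) :
    (P.x k - P.x (i t)) ⬝ᵥ θ < P.eps := by
  -- The confidence bound is not strict for `v = 0`; there `eps > 0` gives the strict inequality.
  by_cases hv : P.x k - P.x (i t) = 0
  · simpa [hv] using heps
  · exact (dotProduct_lt_add_width hlam hθ hn hv).trans_le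
      ((le_ciSup (f := index P a (fun s => P.x (a s) ⬝ᵥ θ + n s) t (i t))
        (Set.finite_range _).bddAbove k).trans hend.2)

/-- The likelihood ratio of the method of mixtures with a Gaussian prior, for noise `n`. -/
noncomputable def mixture (P : Input K d) (a : ℕ → Fin K) (n : ℕ → ℝ) (t : ℕ) : ℝ :=
  √(P.lam • (1 : Matrix (Fin d) (Fin d) ℝ)).det * (√(A P a t).det)⁻¹
    * Real.exp (b P a n t ⬝ᵥ ((A P a t)⁻¹ *ᵥ b P a n t) / (2 * P.R ^ 2))

theorem mixture_zero (hlam : 0 < P.lam) : mixture P a n 0 = 1 := by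
  have h : √(P.lam • (1 : Matrix (Fin d) (Fin d) ℝ)).det ≠ 0 :=
    (Real.sqrt_pos.2 (PosDef.one.smul hlam).det_pos).ne'
  simp only [mixture, A, b, Finset.range_zero, Finset.sum_empty, add_zero, zero_dotProduct,
    zero_div, Real.exp_zero, mul_one]
  exact mul_inv_cancel₀ h

theorem mixture_nonneg : ∀ t, 0 ≤ mixture P a n t := fun t => by unfold mixture; positivity

/-- The determinant lemma and Sherman-Morrison make the new factor exactly the integrand of the
one-step bound, with `c = R²`. -/
theorem mixture_succ (hlam : 0 < P.lam) (a : ℕ → Fin K) (n : ℕ → ℝ) (t : ℕ) :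
    mixture P a n (t + 1) = mixture P a n t
      * ((√(1 + P.x (a t) ⬝ᵥ ((A P a t)⁻¹ *ᵥ P.x (a t))))⁻¹
        * Real.exp ((2 * n t * (P.x (a t) ⬝ᵥ ((A P a t)⁻¹ *ᵥ b P a n t))
          + n t ^ 2 * (P.x (a t) ⬝ᵥ ((A P a t)⁻¹ *ᵥ P.x (a t)))
          - (P.x (a t) ⬝ᵥ ((A P a t)⁻¹ *ᵥ b P a n t)) ^ 2)
            / (1 + P.x (a t) ⬝ᵥ ((A P a t)⁻¹ *ᵥ P.x (a t))) / (2 * P.R ^ 2))) := by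
  have hA := posDef_A hlam a t
  simp only [mixture]
  rw [A_succ, b_succ, quadratic_inv_add_vecMulVec hA, det_add_vecMulVec hA,
    Real.sqrt_mul hA.det_pos.le, mul_inv, add_div, Real.exp_add]
  ring

theorem sqrt_quadratic_le_noiseWidth (hlam : 0 < P.lam) (hdelta : 0 < P.delta) (hR : 0 < P.R)
    {t : ℕ} (h : mixture P a n t < P.delta⁻¹) :
    √(b P a n t ⬝ᵥ ((A P a t)⁻¹ *ᵥ b P a n t)) ≤ noiseWidth P a t := by
  have h1 : 0 < √(P.lam • (1 : Matrix (Fin d) (Fin d) ℝ)).det :=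
    Real.sqrt_pos.2 (PosDef.one.smul hlam).det_pos
  have h2 : 0 < √(A P a t).det := Real.sqrt_pos.2 (posDef_A hlam a t).det_pos
  rw [noiseWidth]
  rw [mixture] at h
  set D := √(P.lam • (1 : Matrix (Fin d) (Fin d) ℝ)).det
  set E := √(A P a t).det
  set Q := b P a n t ⬝ᵥ ((A P a t)⁻¹ *ᵥ b P a n t)
  have h3 : Real.exp (Q / (2 * P.R ^ 2)) < E * D⁻¹ / P.delta := by
    calc _ = E * D⁻¹ * (D * E⁻¹ * Real.exp (Q / (2 * P.R ^ 2))) := by field_simp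
      _ < E * D⁻¹ * P.delta⁻¹ := by gcongr
  have h4 := (Real.lt_log_iff_exp_lt (by positivity)).2 h3
  rw [div_lt_iff₀ (by positivity)] at h4
  rw [← Real.sqrt_sq hR.le, ← Real.sqrt_mul (by positivity)]
  exact Real.sqrt_le_sqrt (by nlinarith)

end Path

/-! ### Measurability of the path quantities -/

section Measurability

variable {Ω : Type*} {mΩ : MeasurableSpace Ω} {K d : ℕ}

theorem measurable_det {N : Ω → Matrix (Fin d) (Fin d) ℝ}
    (hN : ∀ k l, Measurable fun ω => N ω k l) : Measurable fun ω => (N ω).det := by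
  simp only [det_apply]
  fun_prop

theorem measurable_inv_apply {N : Ω → Matrix (Fin d) (Fin d) ℝ}
    (hN : ∀ k l, Measurable fun ω => N ω k l) (k l : Fin d) :
    Measurable fun ω => (N ω)⁻¹ k l := by
  simp only [inv_def, Ring.inverse_eq_inv', Matrix.smul_apply, adjugate_apply, smul_eq_mul]
  refine (measurable_det hN).inv.mul (measurable_det fun k' l' => ?_)
  by_cases h : k' = l
  · subst h; simp
  · simpa [updateRow_ne h] using hN k' l'

theorem measurable_dotProduct_inv_mulVec {N : Ω → Matrix (Fin d) (Fin d) ℝ} {u v : Ω → Fin d → ℝ}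
    (hN : ∀ k l, Measurable fun ω => N ω k l) (hu : ∀ k, Measurable fun ω => u ω k)
    (hv : ∀ k, Measurable fun ω => v ω k) :
    Measurable fun ω => u ω ⬝ᵥ ((N ω)⁻¹ *ᵥ v ω) := by
  have h := measurable_inv_apply hN
  simp only [dotProduct, mulVec]
  exact Finset.measurable_fun_sum _ fun k _ => (hu k).mul
    (Finset.measurable_fun_sum _ fun l _ => (h k l).mul (hv l))

variable {P : Input K d} {a : ℕ → Ω → Fin K} {ν : ℕ → Ω → ℝ} {t : ℕ}

theorem measurable_feature {c : Ω → Fin K} (hc : Measurable c) (k : Fin d) :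
    Measurable fun ω => P.x (c ω) k :=
  (measurable_from_top (f := fun c => P.x c k)).comp hc

theorem measurable_A (ha : ∀ s < t, Measurable (a s)) (k l : Fin d) :
    Measurable fun ω => A P (fun s => a s ω) t k l := by
  simp only [A, Matrix.add_apply, Matrix.sum_apply, vecMulVec_apply]
  refine measurable_const.add (Finset.measurable_fun_sum _ fun s hs => ?_)
  have hs := ha s (Finset.mem_range.1 hs)
  exact (measurable_feature hs k).mul (measurable_feature hs l)

theorem measurable_b (ha : ∀ s < t, Measurable (a s)) (hν : ∀ s < t, Measurable (ν s))
    (k : Fin d) : Measurable fun ω => b P (fun s => a s ω) (fun s => ν s ω) t k := by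
  simp only [b, Finset.sum_apply, Pi.smul_apply, smul_eq_mul]
  refine Finset.measurable_fun_sum _ fun s hs => ?_
  have hs := Finset.mem_range.1 hs
  exact (hν s hs).mul (measurable_feature (ha s hs) k)

theorem measurable_mixture (ha : ∀ s < t, Measurable (a s)) (hν : ∀ s < t, Measurable (ν s)) :
    Measurable fun ω => mixture P (fun s => a s ω) (fun s => ν s ω) t := by
  have h1 := measurable_det (measurable_A (P := P) ha)
  have h2 := measurable_dotProduct_inv_mulVec (measurable_A (P := P) ha) (measurable_b (P := P) ha hν)
    (measurable_b (P := P) ha hν)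
  unfold mixture
  fun_prop

end Measurability

/-! ### The supermartingale and the self-normalised bound -/

section Stochastic

variable {Ω : Type*} {m : MeasurableSpace Ω} {μ : Measure Ω} [IsProbabilityMeasure μ]
  {ℱ : Filtration ℕ m} {K d : ℕ} {P : Input K d} {ν : ℕ → Ω → ℝ} {a : ℕ → Ω → Fin K}

/-- The mixture process is a supermartingale. -/
theorem setLIntegral_mixture_succ_le (hlam : 0 < P.lam) (hR : 0 < P.R)
    (hν : CondSubGaussian μ ℱ P.R ν) (ha : ∀ t, Measurable[ℱ t] (a t)) (t : ℕ) {E : Set Ω}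
    (hE : MeasurableSet[ℱ t] E) :
    ∫⁻ ω in E, ENNReal.ofReal (mixture P (fun s => a s ω) (fun s => ν s ω) (t + 1)) ∂μ
      ≤ ∫⁻ ω in E, ENNReal.ofReal (mixture P (fun s => a s ω) (fun s => ν s ω) t) ∂μ := by
  have ha' : ∀ s ≤ t, Measurable[ℱ t] (a s) := fun s hs => (ha s).mono (ℱ.mono hs) le_rfl
  have ha'' : ∀ s < t, Measurable[ℱ t] (a s) := fun s hs => ha' s hs.le
  have hν' : ∀ s < t, Measurable[ℱ t] (ν s) := fun s hs =>
    (hν.measurable s).mono (ℱ.mono hs) le_rfl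
  have hx : ∀ k, Measurable[ℱ t] fun ω => P.x (a t ω) k := measurable_feature (ha' t le_rfl)
  have hA := fun k l => measurable_A (mΩ := ℱ t) (P := P) ha'' k l
  have hp := measurable_dotProduct_inv_mulVec (mΩ := ℱ t) hA hx (measurable_b (P := P) ha'' hν')
  have hq := measurable_dotProduct_inv_mulVec (mΩ := ℱ t) hA hx hx
  -- The indicator of `E` goes into the weight. Below, `X` is the identity into `Ω` with the
  -- σ-algebra `ℱ t`, so conditioning on `X` is conditioning on `ℱ t`.
  have hG := (measurable_mixture (mΩ := ℱ t) (P := P) ha'' hν').ennreal_ofReal.indicator hE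
  have hc : ((P.R ^ 2).toNNReal : ℝ) = P.R ^ 2 := Real.coe_toNNReal _ (by positivity)
  have h := lintegral_mul_exp_mixture_le (mβ := ℱ t) (μ := μ) (X := id) (Y := ν t)
    (c := (P.R ^ 2).toNNReal) (NNReal.coe_pos.1 (by rw [hc]; positivity))
    (measurable_id'' (ℱ.le t)) ((hν.measurable t).mono (ℱ.le _) le_rfl) (hν.integrable t)
    (fun s => by
      rw [MeasurableSpace.comap_id, hc, mul_comm (P.R ^ 2)]
      exact hν.bound t s) hG hp hq
    (fun ω => dotProduct_inv_mulVec_nonneg (posDef_A hlam _ t) _)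
  rw [← lintegral_indicator (ℱ.le t _ hE), ← lintegral_indicator (ℱ.le t _ hE)]
  refine le_of_eq_of_le (lintegral_congr fun ω => ?_) h
  by_cases hω : ω ∈ E
  · rw [Set.indicator_of_mem hω, id, Set.indicator_of_mem hω, mixture_succ hlam,
      ENNReal.ofReal_mul (mixture_nonneg t), hc]
  · rw [Set.indicator_of_notMem hω, id, Set.indicator_of_notMem hω, zero_mul]

/-- Conditionally sub-Gaussian noise of level `0` vanishes. -/
theorem ae_eq_zero_of_condSubGaussian_zero (hν : CondSubGaussian μ ℱ 0 ν) (t : ℕ) :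
    ∀ᵐ ω ∂μ, ν t ω = 0 := by
  have hle : ∀ s : ℝ, ∫ ω, Real.exp (s * ν t ω) ∂μ ≤ 1 := fun s => by
    rw [← integral_condExp (ℱ.le t)]
    refine (integral_mono_ae integrable_condExp (integrable_const _) (hν.bound t s)).trans ?_
    simp
  -- The bounds at `s = 1` and `s = -1` give `cosh (ν t)` mean at most 1, while `cosh ≥ 1` with
  -- equality only at 0.
  have hnn : ∀ u : ℝ, 0 ≤ Real.exp (1 * u) + Real.exp (-1 * u) - 2 := fun u => by
    have := Real.one_le_cosh u
    rw [Real.cosh_eq] at this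
    simp only [one_mul, neg_mul]
    linarith
  have hint := ((hν.integrable t 1).add (hν.integrable t (-1))).sub (integrable_const (2 : ℝ))
  have h0 : ∫ ω, (Real.exp (1 * ν t ω) + Real.exp (-1 * ν t ω) - 2) ∂μ = 0 := by
    refine le_antisymm ?_ (integral_nonneg fun ω => hnn _)
    have hadd : Integrable (fun ω => Real.exp (1 * ν t ω) + Real.exp (-1 * ν t ω)) μ :=
      (hν.integrable t 1).add (hν.integrable t (-1))
    rw [integral_sub hadd (integrable_const _), integral_add (hν.integrable t 1) (hν.integrable t (-1))]
    have h1 := hle 1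
    have h2 := hle (-1)
    simp only [integral_const, probReal_univ, smul_eq_mul]
    linarith
  filter_upwards [(integral_eq_zero_iff_of_nonneg (fun ω => hnn _) hint).1 h0] with ω hω
  have : Real.cosh (ν t ω) = 1 := by
    rw [Real.cosh_eq]
    simp only [one_mul, neg_mul, Pi.zero_apply] at hω
    linarith
  by_contra hne
  exact (Real.one_lt_cosh.2 hne).ne' this

/-- The self-normalised bound: with probability at least `1 - delta`, the noise is within its
confidence width at all times. -/
theorem measure_noiseWidth_lt_le (hlam : 0 < P.lam) (hdelta : 0 < P.delta) (hR : 0 ≤ P.R)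
    (hν : CondSubGaussian μ ℱ P.R ν) (ha : ∀ t, Measurable[ℱ t] (a t)) :
    μ {ω | ∃ t, noiseWidth P (fun s => a s ω) t
        < √(b P (fun s => a s ω) (fun s => ν s ω) t ⬝ᵥ ((A P (fun s => a s ω) t)⁻¹
          *ᵥ b P (fun s => a s ω) (fun s => ν s ω) t))} ≤ ENNReal.ofReal P.delta := by
  -- The exponent of the mixture divides by `R²`, so `R = 0` is separate: the noise vanishes almost
  -- surely and both sides are 0.
  rcases hR.eq_or_lt with hR | hR
  · refine le_of_eq_of_le (measure_eq_zero_iff_ae_notMem.2 ?_) zero_le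
    filter_upwards [ae_all_iff.2 (ae_eq_zero_of_condSubGaussian_zero (hR ▸ hν))] with ω hω
    simp [noiseWidth, ← hR, b, hω]
  have hville := measure_exists_le_of_supermartingale (μ := μ) (ℱ := ℱ)
    (M := fun t ω => ENNReal.ofReal (mixture P (fun s => a s ω) (fun s => ν s ω) t))
    (fun t => (measurable_mixture (mΩ := ℱ t) (fun s hs => (ha s).mono (ℱ.mono hs.le) le_rfl)
      fun s hs => (hν.measurable s).mono (ℱ.mono hs) le_rfl).ennreal_ofReal)
    (fun t E hE => setLIntegral_mixture_succ_le hlam hR hν ha t hE) (ENNReal.ofReal P.delta⁻¹)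
  simp only [mixture_zero hlam, ENNReal.ofReal_one, lintegral_const, measure_univ,
    mul_one, ENNReal.ofReal_inv_of_pos hdelta] at hville
  have hd : ENNReal.ofReal P.delta ≠ 0 := by simpa using hdelta
  have hle := (ENNReal.inv_mul_le_iff hd ENNReal.ofReal_ne_top).1 hville
  rw [mul_one] at hle
  refine (measure_mono fun ω => ?_).trans hle
  rintro ⟨t, ht⟩
  refine ⟨t, ?_⟩
  rw [← ENNReal.ofReal_inv_of_pos hdelta]
  refine ENNReal.ofReal_le_ofReal (le_of_not_gt fun hlt => ?_)
  exact ht.not_ge (sqrt_quadratic_le_noiseWidth hlam hdelta hR hlt)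

end Stochastic

end LinGapE

theorem theorem1 {Ω : Type*} {m : MeasurableSpace Ω} (μ : Measure Ω) [IsProbabilityMeasure μ]
    (ℱ : Filtration ℕ m) {K d : ℕ} (P : LinGapE.Input K d) (rule : LinGapE.Rule)
    (θ : Fin d → ℝ) (ν : ℕ → Ω → ℝ) (a i j : ℕ → Ω → Fin K) (astar : Fin K)
    (hlam : 0 < P.lam) (heps : 0 < P.eps) (hdelta : 0 < P.delta) (hdelta1 : P.delta < 1)
    (hR : 0 ≤ P.R) (hθ : ‖WithLp.toLp 2 θ‖ < P.S)
    (hν : LinGapE.CondSubGaussian μ ℱ P.R ν)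
    (hrun : LinGapE.IsRun P rule θ ℱ ν a i j)
    (hastar : ∀ k, P.x k ⬝ᵥ θ ≤ P.x astar ⬝ᵥ θ) :
    μ.real {ω | ∃ t, LinGapE.StopsAt P (fun s => a s ω) (LinGapE.reward P θ a ν ω)
        (fun s => i s ω) t ∧ P.eps ≤ (P.x astar - P.x (i t ω)) ⬝ᵥ θ} ≤ P.delta := by
  refine ENNReal.toReal_le_of_le_ofReal hdelta.le ((measure_mono fun ω => ?_).trans
    (LinGapE.measure_noiseWidth_lt_le hlam hdelta hR hν hrun.arm_measurable))
  rintro ⟨t, hend, hle⟩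
  refine ⟨t, lt_of_not_ge fun hn => hle.not_gt ?_⟩
  exact LinGapE.dotProduct_lt_of_stopsAt hlam heps hθ hn hend astar
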